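/- **Theorem (cover time of TSAW on the star graph).** Fix $\rho\in(0,1)$ and set $c_\rho := \frac{1}{\log(1/\rho)}$. For $n\ge 1$, let the reduced true self-avoiding walk (TSAW) on the star graph with $n$ leaves and effective discount parameter $\rho$ be the random sequence $I_1,I_2,\dots$ of leaves in $[n]=\{1,\dots,n\}$ (the successive departures from the hub) with $$\mathbb P(I_{m+1}=i\mid I_1,\dots,I_m)=\frac{\rho^{\,C_m(i)}}{\sum_{j=1}^n\rho^{\,C_m(j)}},\qquad i\in[n],\ m\ge 0,$$ where $C_m(i):=\sum_{r=1}^m\mathbf 1\{I_r=i\}$ is the number of times leaf $i$ has been chosen in the first $m$ hub departures; in particular $C_0(i)=0$ and $I_1$ is uniform on $[n]$. Let $$\tau_{\mathrm{cov}}^{(n)}:=\inf\{m\ge 0:\ C_m(i)\ge 1\ \text{for all } i\in[n]\}\in\{0,1,2,\dots\}\cup\{\infty\}$$ be its cover time, measured in hub departures. Then for every $\varepsilon>0$ and every $\delta>0$ there exists $n_0=n_0(\varepsilon,\delta,\rho)$ such that for all $n\ge n_0$, $$\mathbb P\left(\left|\frac{\tau_{\mathrm{cov}}^{(n)}}{n\log\log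 n}-c_\rho\right|\le\varepsilon\right)\ge 1-\delta .$$ -/

import Mathlib

open MeasureTheory ProbabilityTheory

/-- For a sequence of hub departures `x 0, x 1, x 2, …` (so `x r` is the leaf chosen at the
departure number `r + 1`), `leafCount x m i` is the number of times that leaf `i` has been chosen
in the first `m` hub departures. -/
def leafCount {n : ℕ} (x : ℕ → Fin n) (m : ℕ) (i : Fin n) : ℕ :=
  ((Finset.range m).filter fun r => x r = i).card

/-- The number of hub departures after which every leaf has been chosen at least once; it is `⊤`
when some leaf is never chosen. -/
noncomputable def coverTime {n : ℕ} (x : ℕ → Fin n) : ℕ∞ :=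
  sInf {t : ℕ∞ | ∃ m : ℕ, t = (m : ℕ∞) ∧ ∀ i : Fin n, 1 ≤ leafCount x m i}

/-- `I` is a reduced true self-avoiding walk on the star graph with `n` leaves and effective
discount parameter `ρ`: given the first `m` hub departures, the next one goes to leaf `i` with
probability proportional to `ρ ^ C`, where `C` is the number of earlier departures to `i`.
For `m = 0` this says that the first leaf is chosen uniformly at random. -/
structure IsReducedTSAW {Ω : Type*} [MeasurableSpace Ω] (P : Measure Ω) (n : ℕ) (ρ : ℝ)
    (I : ℕ → Ω → Fin n) : Prop where
  measurable : ∀ r : ℕ, Measurable (I r)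
  cond_next : ∀ (m : ℕ) (h : ℕ → Fin n) (i : Fin n),
    P {ω | ∀ r < m, I r ω = h r} ≠ 0 →
      (P[|{ω | ∀ r < m, I r ω = h r}]).real {ω | I m ω = i} =
        ρ ^ leafCount h m i / ∑ j : Fin n, ρ ^ leafCount h m j

/-! After `n * k` departures the average count is `k`, so the total weight should be about `n * ρ ^
k` and a fresh leaf, of weight `1`, is hit with probability about `ρ⁻¹ ^ k / n` per step. Coverage
occurs when `ρ⁻¹ ^ k` passes `log n`, i.e. `k ≈ c_ρ log log n`. Both directions use a
supermartingale of time and counts (`prob_le`). For the upper bound, a product over the leaves of a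
log-convex function of their counts, restricted to leaf `i` being unvisited, gives an exponentially
small probability of missing `i` (`prob_unvisited_le`); a union bound follows. For the lower bound,
convexity of `ρ ^ c` bounds the total weight below, and the fresh leaves are compared with
independent ones, each hit with probability at most `ρ⁻¹ ^ k / n` per step (`prob_covered_le`). -/

/-! ### Counts and cylinder events. -/

theorem leafCount_succ {n : ℕ} (x : ℕ → Fin n) (m : ℕ) :
    leafCount x (m + 1) = leafCount x m + Pi.single (x m) 1 := by
  funext i
  by_cases h : x m = i
  · subst h
    simp [leafCount, Finset.range_add_one, Finset.filter_insert]
  · have h' : i ≠ x m := fun e => h e.symm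
    simp [leafCount, Finset.range_add_one, Finset.filter_insert, h, h']

theorem leafCount_congr {n : ℕ} {x y : ℕ → Fin n} {m : ℕ} (h : ∀ r < m, x r = y r) :
    leafCount x m = leafCount y m := by
  funext i
  unfold leafCount
  congr 1
  refine Finset.filter_congr fun r hr => ?_
  rw [h r (Finset.mem_range.1 hr)]

theorem sum_leafCount {n : ℕ} (x : ℕ → Fin n) (m : ℕ) : ∑ i, leafCount x m i = m := by
  have := Finset.card_eq_sum_card_fiberwise (s := Finset.range m) (t := Finset.univ) (f := x)
    (fun _ _ => Finset.mem_coe.2 (Finset.mem_univ _))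
  simpa [leafCount] using this.symm

theorem leafCount_mono {n : ℕ} (x : ℕ → Fin n) (i : Fin n) : Monotone fun m => leafCount x m i :=
  fun _ _ h => Finset.card_le_card
    (Finset.filter_subset_filter _ (Finset.range_subset_range.2 h))

theorem measurableSet_cylinder {Ω : Type*} [MeasurableSpace Ω] {n : ℕ} {I : ℕ → Ω → Fin n}
    (hI : ∀ r, Measurable (I r)) (m : ℕ) (h : ℕ → Fin n) :
    MeasurableSet {ω | ∀ r < m, I r ω = h r} := by
  have : {ω | ∀ r < m, I r ω = h r} = ⋂ r, ⋂ (_ : r < m), I r ⁻¹' {h r} := by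
    ext ω; simp
  rw [this]
  exact MeasurableSet.iInter fun r => MeasurableSet.iInter fun _ =>
    hI r (measurableSet_singleton _)

/-- Splitting an event according to the value of a random variable on a finite type. -/
theorem measureReal_eq_sum_fiber {Ω : Type*} [MeasurableSpace Ω] (P : Measure Ω)
    [IsFiniteMeasure P] {n : ℕ} {X : Ω → Fin n} (hX : Measurable X) (A : Set Ω) :
    P.real A = ∑ i, P.real (A ∩ {ω | X ω = i}) := by
  have h : ∀ s : Finset (Fin n), P.real (A ∩ {ω | X ω ∈ s}) =
      ∑ i ∈ s, P.real (A ∩ {ω | X ω = i}) := by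
    intro s
    induction s using Finset.induction_on with
    | empty => simp
    | insert a s ha ih =>
      rw [Finset.sum_insert ha, ← ih]
      have hm : MeasurableSet {ω | X ω = a} := hX (measurableSet_singleton a)
      rw [← measureReal_inter_add_sdiff (s := A ∩ {ω | X ω ∈ insert a s}) hm]
      congr 2
      · ext ω; simp; grind
      · ext ω; simp; grind
  simpa using h Finset.univ

/-! ### The supermartingale bound. -/

namespace IsReducedTSAW

variable {Ω : Type*} [MeasurableSpace Ω] {P : Measure Ω} [IsProbabilityMeasure P] {n : ℕ} {ρ : ℝ}
  {I : ℕ → Ω → Fin n}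

theorem cylinder_step (H : IsReducedTSAW P n ρ I) (m : ℕ) (h : ℕ → Fin n) (i : Fin n) :
    P.real {ω | ∀ r < m + 1, I r ω = Function.update h m i r} =
      P.real {ω | ∀ r < m, I r ω = h r} *
        (ρ ^ leafCount h m i / ∑ j : Fin n, ρ ^ leafCount h m j) := by
  have hset : {ω | ∀ r < m + 1, I r ω = Function.update h m i r} =
      {ω | ∀ r < m, I r ω = h r} ∩ {ω | I m ω = i} := by
    ext ω
    simp only [Set.mem_ofPred_eq, Set.mem_inter_iff]
    constructor
    · intro hω
      refine ⟨fun r hr => ?_, ?_⟩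
      · have := hω r (by omega)
        rwa [Function.update_of_ne (by omega)] at this
      · simpa using hω m (by omega)
    · rintro ⟨h1, h2⟩ r hr
      rcases Nat.lt_succ_iff_lt_or_eq.1 hr with hr | rfl
      · rw [Function.update_of_ne (by omega)]; exact h1 r hr
      · simpa using h2
  rw [hset]
  by_cases h0 : P {ω | ∀ r < m, I r ω = h r} = 0
  · have h1 : P.real {ω | ∀ r < m, I r ω = h r} = 0 := by simp [Measure.real, h0]
    rw [h1, zero_mul]
    exact le_antisymm (h1 ▸ measureReal_mono Set.inter_subset_left) measureReal_nonneg
  · rw [← H.cond_next m h i h0,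
      Measure.real, Measure.real, Measure.real,
      cond_apply (measurableSet_cylinder H.measurable m h), ENNReal.toReal_mul,
      ENNReal.toReal_inv, ← mul_assoc,
      mul_inv_cancel₀, one_mul]
    exact fun e => h0 ((measureReal_eq_zero_iff (measure_ne_top _ _)).1 e)

/-- An event about the counts at time `T` has probability at most the initial value of any
function `Φ` of time and counts that dominates its indicator at time `T` and is a supermartingale
along the walk. -/
theorem prob_le (H : IsReducedTSAW P n ρ I) (hρ : 0 < ρ) (T : ℕ) (Q : (Fin n → ℕ) → Prop)
    (Φ : ℕ → (Fin n → ℕ) → ℝ) (hΦ0 : ∀ c, 0 ≤ Φ T c) (hΦ1 : ∀ c, ∑ i, c i = T → Q c → 1 ≤ Φ T c)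
    (step : ∀ m < T, ∀ c : Fin n → ℕ, ∑ i, c i = m →
      ∑ i, ρ ^ c i * Φ (m + 1) (c + Pi.single i 1) ≤ (∑ j, ρ ^ c j) * Φ m c) :
    P.real {ω | Q (leafCount (fun r => I r ω) T)} ≤ Φ 0 0 := by
  -- Backward induction in time, on the number `d` of steps left after a fixed history of length
  -- `m`.
  have key : ∀ d m, m + d = T → ∀ h : ℕ → Fin n,
      P.real ({ω | ∀ r < m, I r ω = h r} ∩ {ω | Q (leafCount (fun r => I r ω) T)}) ≤
        P.real {ω | ∀ r < m, I r ω = h r} * Φ m (leafCount h m) := by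
    intro d
    induction d with
    | zero =>
      intro m hm h
      obtain rfl : m = T := by simpa using hm
      by_cases hQ : Q (leafCount h m)
      · exact (measureReal_mono Set.inter_subset_left).trans
          (le_mul_of_one_le_right measureReal_nonneg (hΦ1 _ (sum_leafCount h m) hQ))
      · have : {ω | ∀ r < m, I r ω = h r} ∩ {ω | Q (leafCount (fun r => I r ω) m)} = ∅ := by
          ext ω
          simp only [Set.mem_inter_iff, Set.mem_ofPred_eq, Set.mem_empty_iff_false, iff_false]
          rintro ⟨h1, h2⟩
          rw [leafCount_congr h1] at h2
          exact hQ h2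
        rw [this, measureReal_empty]
        exact mul_nonneg measureReal_nonneg (hΦ0 _)
    | succ d ih =>
      intro m hm h
      have hcount : ∀ i, leafCount (Function.update h m i) (m + 1) =
          leafCount h m + Pi.single i 1 := by
        intro i
        rw [leafCount_succ, Function.update_self]
        congr 1
        exact leafCount_congr fun r hr => Function.update_of_ne (by omega) _ _
      have hS : 0 < ∑ j : Fin n, ρ ^ leafCount h m j :=
        Finset.sum_pos (fun j _ => pow_pos hρ _) ⟨h 0, Finset.mem_univ _⟩
      rw [measureReal_eq_sum_fiber P (H.measurable m)]
      calc _ ≤ ∑ i, P.real {ω | ∀ r < m, I r ω = h r} *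
            (ρ ^ leafCount h m i / ∑ j : Fin n, ρ ^ leafCount h m j) *
              Φ (m + 1) (leafCount h m + Pi.single i 1) := by
            refine Finset.sum_le_sum fun i _ => ?_
            rw [← H.cylinder_step, ← hcount]
            refine le_trans (measureReal_mono ?_) (ih (m + 1) (by omega) _)
            rintro ω ⟨⟨h1, h2⟩, h3⟩
            refine ⟨fun r hr => ?_, h2⟩
            rcases Nat.lt_succ_iff_lt_or_eq.1 hr with hr | rfl
            · rw [Function.update_of_ne (by omega)]; exact h1 r hr
            · simpa using h3
        _ = P.real {ω | ∀ r < m, I r ω = h r} *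
            ((∑ i, ρ ^ leafCount h m i * Φ (m + 1) (leafCount h m + Pi.single i 1)) /
              ∑ j : Fin n, ρ ^ leafCount h m j) := by
            rw [Finset.sum_div, Finset.mul_sum]
            refine Finset.sum_congr rfl fun i _ => ?_
            ring
        _ ≤ _ := by
            refine mul_le_mul_of_nonneg_left ?_ measureReal_nonneg
            rw [div_le_iff₀ hS, mul_comm (Φ _ _)]
            exact step m (by omega) _ (sum_leafCount h m)
  obtain ⟨ω₀⟩ : Nonempty Ω := nonempty_of_isProbabilityMeasure P
  have := key T 0 (by simp) (fun r => I r ω₀)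
  have h0 : leafCount (fun r => I r ω₀) 0 = 0 := by funext i; simp [leafCount]
  simpa [h0] using this

end IsReducedTSAW

/-! ### Convexity inequalities. -/

/-- The tangent-line inequality for the log-convex sequence `∏ l < k, (1 + a * ρ⁻¹ ^ l)`. -/
theorem prod_one_add_tangent {a ρ : ℝ} (ha : 0 < a) (hρ0 : 0 < ρ) (hρ1 : ρ < 1) (k c : ℕ) :
    (∏ l ∈ Finset.range k, (1 + a * ρ⁻¹ ^ l)) * (1 + a * ρ⁻¹ ^ k) ^ c ≤
      (∏ l ∈ Finset.range c, (1 + a * ρ⁻¹ ^ l)) * (1 + a * ρ⁻¹ ^ k) ^ k := by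
  have h1 : 1 ≤ ρ⁻¹ := (one_le_inv₀ hρ0).2 hρ1.le
  have hpos : ∀ l : ℕ, 0 < 1 + a * ρ⁻¹ ^ l := fun l => by positivity
  have hmono : ∀ {l k : ℕ}, l ≤ k → 1 + a * ρ⁻¹ ^ l ≤ 1 + a * ρ⁻¹ ^ k := by
    intro l k h
    gcongr
  rcases le_total k c with h | h
  · obtain ⟨d, rfl⟩ := Nat.exists_eq_add_of_le h
    rw [Finset.prod_range_add, pow_add, mul_assoc, mul_comm (∏ x ∈ Finset.range d, _)]
    have : (1 + a * ρ⁻¹ ^ k) ^ d ≤ ∏ x ∈ Finset.range d, (1 + a * ρ⁻¹ ^ (k + x)) := by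
      rw [← Finset.card_range d, ← Finset.prod_const, Finset.card_range]
      exact Finset.prod_le_prod (fun _ _ => (hpos _).le) fun x _ => hmono (by omega)
    have hp := Finset.prod_pos (s := Finset.range k) fun l _ => hpos l
    have := hpos k
    gcongr
  · obtain ⟨d, rfl⟩ := Nat.exists_eq_add_of_le h
    rw [Finset.prod_range_add, pow_add (1 + a * ρ⁻¹ ^ (c + d)) c d, mul_assoc, mul_comm (∏ x ∈ Finset.range d, _)]
    have : ∏ x ∈ Finset.range d, (1 + a * ρ⁻¹ ^ (c + x)) ≤ (1 + a * ρ⁻¹ ^ (c + d)) ^ d := by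
      conv_rhs => rw [← Finset.card_range d, ← Finset.prod_const]
      rw [Finset.card_range]
      exact Finset.prod_le_prod (fun _ _ => (hpos _).le) fun x hx =>
        hmono (by have := Finset.mem_range.1 hx; omega)
    have hp := Finset.prod_pos (s := Finset.range c) fun l _ => hpos l
    have := hpos (c + d)
    gcongr

/-- Jensen for a log-convex sequence: multiplied over `i`, the tangent factors on both sides become
the same power, since the counts average exactly `k`. -/
theorem prod_prod_one_add_ge {n k : ℕ} {a ρ : ℝ} (ha : 0 < a) (hρ0 : 0 < ρ) (hρ1 : ρ < 1)
    (c : Fin n → ℕ) (hc : ∑ i, c i = n * k) :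
    (∏ l ∈ Finset.range k, (1 + a * ρ⁻¹ ^ l)) ^ n ≤
      ∏ i, ∏ l ∈ Finset.range (c i), (1 + a * ρ⁻¹ ^ l) := by
  have h := Finset.prod_le_prod (s := Finset.univ)
    (f := fun i : Fin n => (∏ l ∈ Finset.range k, (1 + a * ρ⁻¹ ^ l)) * (1 + a * ρ⁻¹ ^ k) ^ c i)
    (fun i _ => by positivity) (fun i _ => prod_one_add_tangent ha hρ0 hρ1 k (c i))
  simp only [Finset.prod_mul_distrib, Finset.prod_pow_eq_pow_sum, hc, Finset.sum_const,
    Finset.card_univ, Fintype.card_fin, smul_eq_mul, Finset.prod_const] at h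
  exact le_of_mul_le_mul_right h (by positivity)

/-- The left side is the chord of the convex sequence `ρ ^ c` through `k` and `k + 1`, extended to
all integers; Bernoulli's inequality handles each side of `k`. -/
theorem pow_tangent {ρ : ℝ} (hρ0 : 0 < ρ) (hρ1 : ρ < 1) (k c : ℕ) :
    ρ ^ k * (1 + ((k : ℝ) - c) * (1 - ρ)) ≤ ρ ^ c := by
  rcases le_total k c with h | h
  · obtain ⟨d, rfl⟩ := Nat.exists_eq_add_of_le h
    rw [pow_add]
    have := one_add_mul_sub_le_pow (a := ρ) (by linarith) d
    refine mul_le_mul_of_nonneg_left ?_ (by positivity)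
    push_cast
    linarith
  · obtain ⟨d, rfl⟩ := Nat.exists_eq_add_of_le h
    have h1 : 1 ≤ ρ⁻¹ := (one_le_inv₀ hρ0).2 hρ1.le
    have h2 := one_add_mul_sub_le_pow (a := ρ⁻¹) (by linarith) d
    have h3 : 1 - ρ ≤ ρ⁻¹ - 1 := by
      have : ρ⁻¹ - 1 - (1 - ρ) = (1 - ρ) ^ 2 * ρ⁻¹ := by field_simp
      have : 0 ≤ (1 - ρ) ^ 2 * ρ⁻¹ := by positivity
      linarith
    have h4 : 1 + (d : ℝ) * (1 - ρ) ≤ ρ⁻¹ ^ d :=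
      le_trans (by gcongr) h2
    calc _ = ρ ^ (c + d) * (1 + (d : ℝ) * (1 - ρ)) := by push_cast; ring
      _ ≤ ρ ^ (c + d) * ρ⁻¹ ^ d := by gcongr
      _ = ρ ^ c := by rw [pow_add, inv_pow, mul_assoc, mul_inv_cancel₀ (by positivity), mul_one]

/-- If the average count is at most `k`, the average weight is at least `ρ ^ k`. -/
theorem mul_pow_le_sum_pow {n k : ℕ} {ρ : ℝ} (hρ0 : 0 < ρ) (hρ1 : ρ < 1) (c : Fin n → ℕ)
    (hc : ∑ i, c i ≤ n * k) : n * ρ ^ k ≤ ∑ i, ρ ^ c i := by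
  have hc' : (∑ i, (c i : ℝ)) ≤ n * k := by exact_mod_cast hc
  calc (n : ℝ) * ρ ^ k ≤ n * ρ ^ k + ρ ^ k * (n * k - ∑ i, (c i : ℝ)) * (1 - ρ) := by
        have : 0 ≤ ρ ^ k * (n * k - ∑ i, (c i : ℝ)) * (1 - ρ) :=
          mul_nonneg (mul_nonneg (by positivity) (by linarith)) (by linarith)
        linarith
    _ = ∑ i, ρ ^ k * (1 + ((k : ℝ) - c i) * (1 - ρ)) := by
        simp only [← Finset.mul_sum, Finset.sum_add_distrib, ← Finset.sum_mul,
          Finset.sum_sub_distrib, Finset.sum_const, Finset.card_univ, Fintype.card_fin,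
          nsmul_eq_mul]
        ring
    _ ≤ _ := Finset.sum_le_sum fun i _ => pow_tangent hρ0 hρ1 k (c i)

/-! ### Tail bounds for coverage. -/

namespace IsReducedTSAW

variable {Ω : Type*} [MeasurableSpace Ω] {P : Measure Ω} [IsProbabilityMeasure P] {n : ℕ} {ρ : ℝ}
  {I : ℕ → Ω → Fin n}

/-- With `a = 1 / n`, the `n` gains of `a` sum to `1`, which is the weight lost by forbidding the
fresh leaf `i`; hence the product of the `g (c j)` on that event is a supermartingale. -/
theorem prob_unvisited_le (H : IsReducedTSAW P n ρ I) (hρ0 : 0 < ρ) (hρ1 : ρ < 1) (k : ℕ)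
    (i : Fin n) :
    P.real {ω | leafCount (fun r => I r ω) (n * k) i = 0} ≤
      ((∏ l ∈ Finset.range k, (1 + (n : ℝ)⁻¹ * ρ⁻¹ ^ l)) ^ n)⁻¹ := by
  have hn : (0 : ℝ) < n := by exact_mod_cast i.pos
  set a : ℝ := (n : ℝ)⁻¹ with ha_def
  have ha : 0 < a := inv_pos.2 hn
  set g : ℕ → ℝ := fun k => ∏ l ∈ Finset.range k, (1 + a * ρ⁻¹ ^ l) with hg
  have hgpos : ∀ k, 0 < g k := fun k => Finset.prod_pos fun l _ => by positivity
  have hgs : ∀ k, ρ ^ k * g (k + 1) = (ρ ^ k + a) * g k := by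
    intro k
    simp only [hg, Finset.prod_range_succ]
    have : ρ ^ k * ρ⁻¹ ^ k = 1 := by rw [← mul_pow, mul_inv_cancel₀ hρ0.ne', one_pow]
    linear_combination (∏ l ∈ Finset.range k, (1 + a * ρ⁻¹ ^ l)) * a * this
  have main := H.prob_le hρ0 (n * k) (fun c => c i = 0)
    (fun _ c => if c i = 0 then (∏ j, g (c j)) * (g k ^ n)⁻¹ else 0)
    (fun c => by
      split_ifs
      · exact mul_nonneg (Finset.prod_nonneg fun j _ => (hgpos _).le)
          (inv_nonneg.2 (pow_nonneg (hgpos k).le _))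
      · rfl)
    (fun c hc hQ => by
      rw [if_pos hQ, ← div_eq_mul_inv, one_le_div (pow_pos (hgpos k) _)]
      exact prod_prod_one_add_ge ha hρ0 hρ1 c hc)
    (fun m _ c _ => by
      by_cases hci : c i = 0
      · have hterm : ∀ j, ρ ^ c j * (if (c + Pi.single j 1 : Fin n → ℕ) i = 0 then
            (∏ l, g ((c + Pi.single j 1 : Fin n → ℕ) l)) * (g k ^ n)⁻¹ else 0) =
            (if j = i then 0 else ρ ^ c j + a) * ((∏ l, g (c l)) * (g k ^ n)⁻¹) := by
          intro j
          by_cases hji : j = i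
          · subst hji; simp
          · have h0 : (c + Pi.single j 1 : Fin n → ℕ) i = 0 := by
              simp [hci, Pi.single_eq_of_ne (Ne.symm hji)]
            rw [if_pos h0, if_neg hji, ← Finset.mul_prod_erase _ _ (Finset.mem_univ j),
              ← Finset.mul_prod_erase _ (fun l => g (c l)) (Finset.mem_univ j)]
            have : ∏ l ∈ Finset.univ.erase j, g ((c + Pi.single j 1 : Fin n → ℕ) l) =
                ∏ l ∈ Finset.univ.erase j, g (c l) := by
              refine Finset.prod_congr rfl fun l hl => ?_
              simp [Pi.single_eq_of_ne (Finset.ne_of_mem_erase hl)]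
            rw [this]
            simp only [Pi.add_apply, Pi.single_eq_same]
            linear_combination ((∏ l ∈ Finset.univ.erase j, g (c l)) * (g k ^ n)⁻¹) * hgs (c j)
        rw [Finset.sum_congr rfl fun j _ => hterm j, ← Finset.sum_mul, if_pos hci]
        refine mul_le_mul_of_nonneg_right ?_ (mul_nonneg
          (Finset.prod_nonneg fun j _ => (hgpos _).le) (inv_nonneg.2 (pow_nonneg (hgpos k).le _)))
        -- At `j = i` this discards a surplus `a`, so that the sum is exactly the total weight.
        have h1 : ∀ j, (if j = i then 0 else ρ ^ c j + a) ≤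
            ρ ^ c j + a - (if j = i then 1 else 0) := by
          intro j
          split_ifs with h
          · subst h; rw [hci]; simp [ha.le]
          · simp
        refine (Finset.sum_le_sum fun j _ => h1 j).trans (le_of_eq ?_)
        simp [Finset.sum_add_distrib, ha_def, hn.ne']
      · rw [if_neg hci, mul_zero]
        refine le_of_eq (Finset.sum_eq_zero fun j _ => ?_)
        rw [if_neg (by simp [hci]), mul_zero])
  refine main.trans (le_of_eq ?_)
  simp [hg]

theorem prob_exists_unvisited_le (H : IsReducedTSAW P n ρ I) (hρ0 : 0 < ρ) (hρ1 : ρ < 1) {k : ℕ}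
    (hk : k ≠ 0) {y : ℝ} (hy0 : 0 ≤ y) (hyn : y ≤ n) (hy : y ≤ ρ * ρ⁻¹ ^ k) :
    P.real {ω | ∃ i, leafCount (fun r => I r ω) (n * k) i = 0} ≤ n * Real.exp (-(y / 2)) := by
  have hn0 : 0 < n := by
    obtain ⟨ω₀⟩ : Nonempty Ω := nonempty_of_isProbabilityMeasure P
    exact (I 0 ω₀).pos
  have hn : (0 : ℝ) < n := by exact_mod_cast hn0
  have h1 : 1 ≤ ρ⁻¹ := (one_le_inv₀ hρ0).2 hρ1.le
  have hg : Real.exp (y / 2 / n) ≤ ∏ l ∈ Finset.range k, (1 + (n : ℝ)⁻¹ * ρ⁻¹ ^ l) := by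
    have hexp : Real.exp (y / 2 / n) ≤ 1 + y / n := by
      have hz0 : 0 ≤ y / n := by positivity
      have hz1 : y / n ≤ 1 := (div_le_one hn).2 hyn
      have h3 : 1 - y / 2 / n ≤ Real.exp (-(y / 2 / n)) := by
        linarith [Real.add_one_le_exp (-(y / 2 / n))]
      have h4 : y / 2 / n = y / n / 2 := by ring
      rw [Real.exp_neg, h4] at h3
      rw [h4]
      have h5 := Real.exp_pos (y / n / 2)
      have h6 : (1 - y / n / 2) * Real.exp (y / n / 2) ≤ 1 := by
        calc _ ≤ (Real.exp (y / n / 2))⁻¹ * Real.exp (y / n / 2) := by gcongr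
          _ = 1 := inv_mul_cancel₀ h5.ne'
      have h7 : 1 ≤ (1 - y / n / 2) * (1 + y / n) := by nlinarith
      exact le_of_mul_le_mul_left (h6.trans h7) (by linarith)
    rcases k with _ | k
    · exact absurd rfl hk
    -- Only the largest factor, of index `k - 1`, is kept; hence the extra `ρ` in `hy`.
    · rw [Finset.prod_range_succ]
      have h2 : 1 ≤ ∏ l ∈ Finset.range k, (1 + (n : ℝ)⁻¹ * ρ⁻¹ ^ l) :=
        Finset.one_le_prod fun l _ => by
          have : 0 ≤ (n : ℝ)⁻¹ * ρ⁻¹ ^ l := by positivity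
          linarith
      refine hexp.trans (le_trans ?_ (le_mul_of_one_le_left (by positivity) h2))
      have : y ≤ ρ⁻¹ ^ k := by
        rwa [pow_succ', ← mul_assoc, mul_inv_cancel₀ hρ0.ne', one_mul] at hy
      rw [div_eq_inv_mul]
      gcongr
  have hset : {ω | ∃ i, leafCount (fun r => I r ω) (n * k) i = 0} =
      ⋃ i, {ω | leafCount (fun r => I r ω) (n * k) i = 0} := by
    ext ω; simp
  rw [hset]
  refine (measureReal_iUnion_fintype_le _).trans ?_
  calc _ ≤ ∑ i : Fin n, Real.exp (-(y / 2)) := by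
        refine Finset.sum_le_sum fun i _ => (H.prob_unvisited_le hρ0 hρ1 k i).trans ?_
        rw [Real.exp_neg]
        refine inv_anti₀ (Real.exp_pos _) ?_
        calc Real.exp (y / 2) = Real.exp (y / 2 / n) ^ n := by
              rw [← Real.exp_nat_mul]; congr 1; field_simp
          _ ≤ _ := by gcongr
    _ = _ := by simp

theorem prob_covered_le (H : IsReducedTSAW P n ρ I) (hρ0 : 0 < ρ) (hρ1 : ρ < 1) (k : ℕ)
    (hk : ρ⁻¹ ^ k / n ≤ 1) :
    P.real {ω | ∀ i, 1 ≤ leafCount (fun r => I r ω) (n * k) i} ≤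
      (1 - (1 - ρ⁻¹ ^ k / n) ^ (n * k)) ^ n := by
  have hn0 : 0 < n := by
    obtain ⟨ω₀⟩ : Nonempty Ω := nonempty_of_isProbabilityMeasure P
    exact (I 0 ω₀).pos
  have hn : (0 : ℝ) < n := by exact_mod_cast hn0
  set q : ℝ := ρ⁻¹ ^ k / n with hq
  have hq0 : 0 ≤ q := by positivity
  set T := n * k
  -- `b m` is the chance that a leaf hit with probability `q` per step is hit in the remaining `T -
  -- m` steps.
  set b : ℕ → ℝ := fun m => 1 - (1 - q) ^ (T - m) with hb
  have hb0 : ∀ m, 0 ≤ b m := fun m =>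
    sub_nonneg.2 (pow_le_one₀ (by linarith) (by linarith))
  have hb1 : ∀ m, b m ≤ 1 := fun m =>
    sub_le_self _ (pow_nonneg (by linarith) _)
  have main := H.prob_le hρ0 T (fun c => ∀ i, 1 ≤ c i)
    (fun m c => b m ^ (Finset.univ.filter fun j => c j = 0).card)
    (fun c => pow_nonneg (hb0 _) _)
    (fun c _ hQ => by
      have : (Finset.univ.filter fun j => c j = 0) = ∅ := by
        ext j
        have := hQ j
        simp; omega
      rw [this]; simp)
    (fun m hm c hc => by
      have hbm : b m = b (m + 1) + q * (1 - b (m + 1)) := by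
        simp only [hb]
        rw [show T - m = (T - (m + 1)) + 1 by omega, pow_succ]
        ring
      set B := b (m + 1)
      have hB0 : 0 ≤ B := hb0 _
      have hB1 : B ≤ 1 := hb1 _
      set Z := Finset.univ.filter fun j => c j = 0 with hZ
      have hfilter : ∀ j, (Finset.univ.filter fun l => (c + Pi.single j 1 : Fin n → ℕ) l = 0) = Z.erase j := by
        intro j
        ext l
        by_cases hl : l = j
        · subst hl; simp
        · simp [hZ, hl]
      simp only [hfilter]
      -- A fresh leaf has weight `1`, so its chance of being chosen is at most `q`.
      have hS : 1 ≤ (∑ j, ρ ^ c j) * q := by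
        have h1 := mul_pow_le_sum_pow hρ0 hρ1 (k := k) c (by omega)
        calc (1 : ℝ) = n * ρ ^ k * q := by
              rw [hq, inv_pow]; field_simp
          _ ≤ _ := by gcongr
      have hterm : ∀ j, ρ ^ c j * B ^ (Z.erase j).card =
          ρ ^ c j * B ^ Z.card + if j ∈ Z then B ^ (Z.card - 1) * (1 - B) else 0 := by
        intro j
        split_ifs with hj
        · have hcj : c j = 0 := by simpa [hZ] using hj
          have : Z.card = (Z.card - 1) + 1 := by
            have := Finset.card_pos.2 ⟨j, hj⟩
            omega
          rw [Finset.card_erase_of_mem hj, hcj]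
          nth_rw 2 [this]
          rw [pow_succ]
          ring
        · rw [Finset.erase_eq_of_notMem hj, add_zero]
      rw [Finset.sum_congr rfl fun j _ => hterm j, Finset.sum_add_distrib, ← Finset.sum_mul,
        Finset.sum_ite_mem, Finset.univ_inter, Finset.sum_const, nsmul_eq_mul]
      have hS0 : 0 ≤ ∑ j, ρ ^ c j := Finset.sum_nonneg fun j _ => by positivity
      rcases hu : Z.card with _ | u
      · simp
      · rw [hbm]
        -- Bernoulli: one step visits at most one fresh leaf, which is no better for coverage than
        -- independent trials.
        have h2 := pow_add_mul_le_add_pow_of_sq_nonneg (b := q * (1 - B)) hB0 (sq_nonneg _)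
            (sq_nonneg _) (by have := mul_nonneg hq0 (sub_nonneg.2 hB1); linarith) (u + 1)
        refine le_trans ?_ (mul_le_mul_of_nonneg_left h2 hS0)
        have h3 : 0 ≤ ((u : ℝ) + 1) * B ^ u * (1 - B) :=
          mul_nonneg (by positivity) (by linarith)
        have h4 := mul_le_mul_of_nonneg_right hS h3
        push_cast
        linarith)
  refine main.trans (le_of_eq ?_)
  simp [hb]

theorem prob_covered_le_exp (H : IsReducedTSAW P n ρ I) (hρ0 : 0 < ρ) (hρ1 : ρ < 1) (k : ℕ)
    (hk : ρ⁻¹ ^ k / n ≤ 1 / 2) :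
    P.real {ω | ∀ i, 1 ≤ leafCount (fun r => I r ω) (n * k) i} ≤
      Real.exp (-(n * Real.exp (-(2 * k * ρ⁻¹ ^ k)))) := by
  have hn0 : 0 < n := by
    obtain ⟨ω₀⟩ : Nonempty Ω := nonempty_of_isProbabilityMeasure P
    exact (I 0 ω₀).pos
  have hn : (0 : ℝ) < n := by exact_mod_cast hn0
  refine (H.prob_covered_le hρ0 hρ1 k (by linarith)).trans ?_
  set q : ℝ := ρ⁻¹ ^ k / n with hq
  have hq0 : 0 ≤ q := by positivity
  have h1 : Real.exp (-(2 * q)) ≤ 1 - q := by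
    rw [Real.exp_neg]
    refine inv_le_of_inv_le₀ (by linarith) ?_
    refine le_trans ?_ (Real.add_one_le_exp (2 * q))
    rw [inv_le_iff_one_le_mul₀ (by linarith)]
    nlinarith
  have h2 : Real.exp (-(2 * k * ρ⁻¹ ^ k)) ≤ (1 - q) ^ (n * k) := by
    calc _ = Real.exp (-(2 * q)) ^ (n * k) := by
          rw [← Real.exp_nat_mul]; congr 1; rw [hq]; push_cast; field_simp
      _ ≤ _ := by gcongr
  have h3 : (1 - q) ^ (n * k) ≤ 1 := pow_le_one₀ (by linarith) (by linarith)
  calc (1 - (1 - q) ^ (n * k)) ^ n ≤ Real.exp (-Real.exp (-(2 * k * ρ⁻¹ ^ k))) ^ n := by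
        refine pow_le_pow_left₀ (by linarith) ?_ n
        linarith [Real.add_one_le_exp (-Real.exp (-(2 * k * ρ⁻¹ ^ k)))]
    _ = _ := by rw [← Real.exp_nat_mul]; congr 1; ring

end IsReducedTSAW

/-! ### From coverage at fixed times to the asymptotics. -/

theorem coverTime_bounds {n : ℕ} (x : ℕ → Fin n) {m₁ m₂ : ℕ}
    (h₁ : ¬ ∀ i, 1 ≤ leafCount x m₁ i) (h₂ : ∀ i, 1 ≤ leafCount x m₂ i) :
    coverTime x ≠ ⊤ ∧ m₁ ≤ (coverTime x).toNat ∧ (coverTime x).toNat ≤ m₂ := by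
  have hle : coverTime x ≤ m₂ := sInf_le ⟨m₂, rfl, h₂⟩
  have htop : coverTime x ≠ ⊤ := ne_top_of_le_ne_top (ENat.natCast_ne_top m₂) hle
  refine ⟨htop, ?_, ?_⟩
  · have : (m₁ : ℕ∞) ≤ coverTime x := by
      refine le_sInf ?_
      rintro _ ⟨m, rfl, hm⟩
      by_contra hlt
      have hlt' : m ≤ m₁ := by exact_mod_cast (not_le.1 hlt).le
      exact h₁ fun i => (hm i).trans (leafCount_mono x i hlt')
    rw [← ENat.natCast_toNat htop] at this
    exact_mod_cast this
  · rw [← ENat.natCast_toNat htop] at hle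
    exact_mod_cast hle

open Filter Asymptotics in
theorem mainTheorem2 (ρ : ℝ) (hρ0 : 0 < ρ) (hρ1 : ρ < 1) (ε : ℝ) (hε : 0 < ε)
    (δ : ℝ) (hδ : 0 < δ) :
    ∃ n₀ : ℕ, ∀ n : ℕ, n₀ ≤ n →
      ∀ (Ω : Type*) [MeasurableSpace Ω] (P : Measure Ω) [IsProbabilityMeasure P]
        (I : ℕ → Ω → Fin n), IsReducedTSAW P n ρ I →
          1 - δ ≤ P.real {ω | coverTime (fun r => I r ω) ≠ ⊤ ∧
            |((coverTime (fun r => I r ω)).toNat : ℝ) / ((n : ℝ) * Real.log (Real.log (n : ℝ)))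
              - 1 / Real.log (1 / ρ)| ≤ ε} := by
  set κ := Real.log (1 / ρ) with hκ
  have hκ0 : 0 < κ := Real.log_pos ((one_lt_div hρ0).2 hρ1)
  have hpow : ∀ k : ℕ, ρ⁻¹ ^ k = Real.exp (κ * k) := by
    intro k
    rw [mul_comm, Real.exp_nat_mul, hκ, Real.exp_log (by positivity), one_div]
  obtain ⟨c₁, hc₁, hc₁'⟩ : ∃ c₁, max 0 (1 / κ - ε) < c₁ ∧ c₁ < 1 / κ :=
    exists_between (max_lt (by positivity) (by linarith))
  obtain ⟨c₂, hc₂, hc₂'⟩ : ∃ c₂, 1 / κ < c₂ ∧ c₂ < 1 / κ + ε := exists_between (by linarith)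
  obtain ⟨hc₁0, hc₁ε⟩ := max_lt_iff.1 hc₁
  have hκc₁ : 0 < 1 - κ * c₁ := by
    rw [lt_div_iff₀ hκ0] at hc₁'; linarith
  have hκc₂ : 0 < κ * c₂ - 1 := by
    rw [div_lt_iff₀ hκ0] at hc₂; linarith
  have hlog : Tendsto (fun n : ℕ => Real.log n) atTop atTop :=
    Real.tendsto_log_atTop.comp tendsto_natCast_atTop_atTop
  have hloglog : Tendsto (fun n : ℕ => Real.log (Real.log n)) atTop atTop :=
    Real.tendsto_log_atTop.comp hlog
  have hmul : ∀ {d : ℝ}, 0 < d → Tendsto (fun x : ℝ => d * x) atTop atTop :=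
    fun hd => tendsto_id.const_mul_atTop hd
  have hexp : (fun x : ℝ => x) =o[atTop] Real.exp := by
    simpa using Real.isLittleO_pow_exp_atTop (n := 1)
  have e1 : ∀ᶠ x : ℝ in atTop, 4 * c₁ * x ≤ Real.exp ((1 - κ * c₁) * x) := by
    have h := (hexp.comp_tendsto (hmul hκc₁)).bound
      (c := (1 - κ * c₁) / (4 * c₁)) (by positivity)
    filter_upwards [h, eventually_gt_atTop 0] with x hx hx0
    simp only [Function.comp, Real.norm_eq_abs, abs_of_pos (mul_pos hκc₁ hx0),
      abs_of_pos (Real.exp_pos _)] at hx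
    rw [div_mul_eq_mul_div, le_div_iff₀ (by positivity)] at hx
    refine le_of_mul_le_mul_left ?_ hκc₁
    linarith
  have e2 : ∀ᶠ x : ℝ in atTop, 4 / ρ ≤ Real.exp ((κ * c₂ - 1) * x) :=
    (Real.tendsto_exp_atTop.comp (hmul hκc₂)).eventually_ge_atTop _
  -- `e3` and `e4` absorb the rounding of `k₁` and `k₂` to integers.
  have e3 : ∀ᶠ x : ℝ in atTop, 1 ≤ (c₁ - (1 / κ - ε)) * x :=
    (hmul (by linarith)).eventually_ge_atTop _
  have e4 : ∀ᶠ x : ℝ in atTop, 1 ≤ (1 / κ + ε - c₂) * x :=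
    (hmul (by linarith)).eventually_ge_atTop _
  have e5 : ∀ᶠ y : ℝ in atTop, 4 * y ≤ Real.exp y := by
    filter_upwards [hexp.bound (c := 1 / 4) (by norm_num),
      eventually_gt_atTop 0] with y hy hy0
    simp only [Real.norm_eq_abs, abs_of_pos hy0, abs_of_pos (Real.exp_pos _)] at hy
    linarith
  have e6 : ∀ᶠ y : ℝ in atTop, Real.exp (-y) ≤ δ / 2 :=
    (Real.tendsto_exp_neg_atTop_nhds_zero.eventually_lt_const (half_pos hδ)).mono fun _ h => h.le
  have e7 : ∀ᶠ y : ℝ in atTop, Real.exp (-Real.exp (y / 2)) ≤ δ / 2 :=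
    (Real.tendsto_exp_atTop.comp (tendsto_id.atTop_div_const two_pos)).eventually e6
  obtain ⟨n₀, hn₀⟩ := eventually_atTop.1 ((hloglog.eventually
    (e1.and (e2.and (e3.and (e4.and (eventually_gt_atTop 0)))))).and (hlog.eventually
      (e5.and (e6.and (e7.and (eventually_gt_atTop 0))))))
  refine ⟨n₀, fun n hn Ω _ P _ I H => ?_⟩
  obtain ⟨⟨h1, h2, h3, h4, hx0⟩, h5, h6, h7, hL0⟩ := hn₀ n hn
  set L := Real.log n with hL
  set x := Real.log L with hx
  have hn0 : (0 : ℝ) < n := by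
    rcases Nat.eq_zero_or_pos n with rfl | h
    · simp [hL] at hL0
    · exact_mod_cast h
  have hexpL : Real.exp L = n := Real.exp_log hn0
  have hexpx : Real.exp x = L := Real.exp_log hL0
  rw [hexpL] at h5
  set k₁ := ⌊c₁ * x⌋₊ with hk₁
  set k₂ := ⌈c₂ * x⌉₊ with hk₂
  have hk₁le : (k₁ : ℝ) ≤ c₁ * x := Nat.floor_le (by positivity)
  have hk₁ge : c₁ * x - 1 ≤ k₁ := (Nat.sub_one_lt_floor _).le
  have hk₂ge : c₂ * x ≤ k₂ := Nat.le_ceil _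
  have hk₂le : (k₂ : ℝ) ≤ c₂ * x + 1 :=
    (Nat.ceil_lt_add_one (mul_nonneg ((by positivity : (0 : ℝ) ≤ 1 / κ).trans hc₂.le) hx0.le)).le
  have hk₂pos : 0 < c₂ * x := mul_pos ((by positivity : (0 : ℝ) < 1 / κ).trans hc₂) hx0
  have hupper : P.real {ω | ∃ i, leafCount (fun r => I r ω) (n * k₂) i = 0} ≤ δ / 2 := by
    -- The constant `4` turns the union bound into `n * exp (-2L) = 1 / n`.
    have hy : 4 * L ≤ ρ * ρ⁻¹ ^ k₂ := by
      rw [hpow]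
      calc 4 * L = ρ * (4 / ρ * Real.exp x) := by rw [hexpx]; field_simp
        _ ≤ ρ * (Real.exp ((κ * c₂ - 1) * x) * Real.exp x) := by gcongr
        _ = ρ * Real.exp (κ * (c₂ * x)) := by rw [← Real.exp_add]; ring_nf
        _ ≤ _ := by gcongr
    refine (H.prob_exists_unvisited_le hρ0 hρ1 (Nat.ceil_pos.2 hk₂pos).ne' (by positivity) h5 hy).trans ?_
    calc (n : ℝ) * Real.exp (-(4 * L / 2)) = Real.exp (-L) := by
          rw [← hexpL, ← Real.exp_add]; ring_nf
      _ ≤ _ := h6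
  have hlower : P.real {ω | ∀ i, 1 ≤ leafCount (fun r => I r ω) (n * k₁) i} ≤ δ / 2 := by
    have hp : ρ⁻¹ ^ k₁ ≤ Real.exp (κ * c₁ * x) := by
      rw [hpow, mul_assoc]; gcongr
    have hpL : ρ⁻¹ ^ k₁ ≤ L := by
      refine hp.trans ?_
      rw [← hexpx]
      gcongr
      nlinarith
    have hq : ρ⁻¹ ^ k₁ / n ≤ 1 / 2 := by
      rw [div_le_iff₀ hn0]; linarith
    refine (H.prob_covered_le_exp hρ0 hρ1 k₁ hq).trans (le_trans ?_ h7)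
    -- This makes `n * exp (-(2 * k₁ * ρ⁻¹ ^ k₁))` at least `√n`.
    have hprod : 2 * k₁ * ρ⁻¹ ^ k₁ ≤ L / 2 := by
      calc 2 * k₁ * ρ⁻¹ ^ k₁ ≤ 2 * (c₁ * x) * Real.exp (κ * c₁ * x) := by gcongr
        _ = (4 * c₁ * x) * Real.exp (κ * c₁ * x) / 2 := by ring
        _ ≤ Real.exp ((1 - κ * c₁) * x) * Real.exp (κ * c₁ * x) / 2 := by gcongr
        _ = L / 2 := by rw [← Real.exp_add, ← hexpx]; ring_nf
    gcongr
    calc Real.exp (L / 2) = n * Real.exp (-(L / 2)) := by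
          rw [← hexpL, ← Real.exp_add]; ring_nf
      _ ≤ _ := by gcongr
  set A := {ω | ∃ i, leafCount (fun r => I r ω) (n * k₂) i = 0}
  set B := {ω | ∀ i, 1 ≤ leafCount (fun r => I r ω) (n * k₁) i}
  have hAB : P.real (A ∪ B) ≤ δ := (measureReal_union_le A B).trans (by linarith)
  have huniv : 1 ≤ P.real (A ∪ B) + P.real (A ∪ B)ᶜ := by
    rw [← probReal_univ (μ := P), ← Set.union_compl_self (A ∪ B)]
    exact measureReal_union_le _ _
  refine le_trans (by linarith) (measureReal_mono (s₁ := (A ∪ B)ᶜ) ?_)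
  intro ω hω
  rw [Set.mem_compl_iff, Set.mem_union, not_or] at hω
  obtain ⟨htop, hge, hle⟩ := coverTime_bounds (fun r => I r ω) (m₁ := n * k₁) (m₂ := n * k₂) hω.2
    (fun i => Nat.one_le_iff_ne_zero.2 fun h0 => hω.1 ⟨i, h0⟩)
  refine ⟨htop, ?_⟩
  have hge' : (n : ℝ) * k₁ ≤ (coverTime fun r => I r ω).toNat := by exact_mod_cast hge
  have hle' : ((coverTime fun r => I r ω).toNat : ℝ) ≤ n * k₂ := by exact_mod_cast hle
  have hnx : 0 < n * x := mul_pos hn0 hx0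
  rw [abs_le]
  constructor
  · have : 1 / κ - ε ≤ ((coverTime fun r => I r ω).toNat : ℝ) / (n * x) := by
      rw [le_div_iff₀ hnx]
      refine le_trans ?_ hge'
      calc (1 / κ - ε) * (n * x) = n * ((1 / κ - ε) * x) := by ring
        _ ≤ n * k₁ := by gcongr; linarith
    linarith
  · have : ((coverTime fun r => I r ω).toNat : ℝ) / (n * x) ≤ 1 / κ + ε := by
      rw [div_le_iff₀ hnx]
      refine hle'.trans ?_
      calc (n : ℝ) * k₂ ≤ n * ((1 / κ + ε) * x) := by gcongr; linarith
        _ = _ := by ring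
    linarith
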